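/- Let $1<p<\infty$, $p'=\frac{p}{p-1}$. Let $v_0,v_1\ge 0$ be weights on $(0,\infty)$, i.e. $v_0,v_1\in L^p_{\rm loc}(0,\infty)$ are nonnegative and not a.e. zero, such that $\frac1{v_1}\in L^{p'}_{\rm loc}(0,\infty)$ (with $\frac10=\infty$, so $v_1>0$ a.e.) and, for some $c_0\in(0,\infty)$, $$\|v_1^{-1}\|_{L^{p'}(0,c_0)}\|v_0\|_{L^p(0,c_0)}=\|v_1^{-1}\|_{L^{p'}(c_0,\infty)}\|v_0\|_{L^p(c_0,\infty)}=\infty\qquad(0\cdot\infty:=0).$$ For $t>0$ let $0<a(t)<t<b(t)<\infty$ be the unique numbers such that $$\int_{a(t)}^t v_1^{-p'}=\int_t^{b(t)}v_1^{-p'},\qquad \Bigl(\int_{a(t)}^{b(t)}v_1^{-p'}\Bigr)^{1/p'}\Bigl(\int_{a(t)}^{b(t)}v_0^{p}\Bigr)^{1/p}=1;$$ the function $a$ is strictly increasing, $a^{-1}$ denotes its inverse (with $a^{-1}(t):=\infty$ if $t\ge\sup a$), and $V_1(t):=\int_{a(t)}^{b(t)}v_1^{-p'}$. For $g\in L^1_{\rm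 loc}(0,\infty)$ put $$\mathbb G(g):=\Bigl(\int_0^\infty v_1^{-p'}(t)\Bigl|\int_t^{a^{-1}(t)}\frac{g(x)}{V_1(x)}\Bigl(\int_{a(x)}^t v_1^{-p'}\Bigr)dx\Bigr|^{p'}dt\Bigr)^{1/p'},$$ $$\mathcal G(g):=\Bigl(\int_0^\infty v_1^{-p'}(t)V_1^{p'}(t)\Bigl|\int_t^{a^{-1}(t)}\frac{g(x)}{V_1(x)}dx\Bigr|^{p'}dt\Bigr)^{1/p'},$$ $$\mathsf G(g):=\Bigl(\int_0^\infty\Bigl(\int_t^{a^{-1}(t)}|g(x)|\,dx\Bigr)^{p'}v_1^{-p'}(t)\,dt\Bigr)^{1/p'},$$ and let $\mathbb W_{p',1/v_1}:=\{g\in L^1_{\rm loc}(0,\infty):\mathsf G(g)<\infty\}$ and $\|g\|_{\mathscr W_{p',1/v_1}}:=\mathbb G(g)+\mathcal G(g)$. Then for every segment $[c,d]\subset(0,\infty)$, every $h\in L^1([c,d])$ and every $\varepsilon>0$ there exists $g\in\mathbb W_{p',1/v_1}$ such that $|g|=|h|$ on $[c,d]$ and $\|g\|_{\mathscr W_{p',1/v_1}}<\varepsilon$.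 -/

import Mathlib

open Set MeasureTheory
open scoped ENNReal

namespace WeightedSobolev

/-- The class `𝒱_q(0,∞)` of weights: nonnegative functions in `L^q_loc(0,∞)` which do not vanish
almost everywhere. Only the values on `(0,∞)` matter, up to null sets. -/
structure IsWeight (q : ℝ) (v : ℝ → ℝ) : Prop where
  aemeasurable : AEMeasurable v (volume.restrict (Ioi 0))
  nonneg : ∀ᵐ x ∂(volume.restrict (Ioi (0 : ℝ))), 0 ≤ v x
  locallyIntegrable : LocallyIntegrableOn (fun x => v x ^ q) (Ioi 0) volume
  ne_zero : eLpNorm v 1 (volume.restrict (Ioi (0 : ℝ))) ≠ 0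

/-- For a weight `v`, the condition `1 / v ∈ L^q_loc(0,∞)`, where `1 / 0 = ∞`: so `v` is positive
almost everywhere and `v ^ (-q)` is locally integrable. -/
def InvLocLp (q : ℝ) (v : ℝ → ℝ) : Prop :=
  (∀ᵐ x ∂(volume.restrict (Ioi (0 : ℝ))), 0 < v x) ∧
    LocallyIntegrableOn (fun x => v x ^ (-q)) (Ioi 0) volume

/-- There is `c ∈ (0,∞)` with
`‖1/v₁‖_{L^{p'}(0,c)} ‖v₀‖_{L^p(0,c)} = ‖1/v₁‖_{L^{p'}(c,∞)} ‖v₀‖_{L^p(c,∞)} = ∞`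
(with `0 · ∞ = 0`). -/
def EndpointCondition (p : ℝ) (v₀ v₁ : ℝ → ℝ) : Prop :=
  ∃ c : ℝ, 0 < c ∧
    eLpNorm (fun x => (v₁ x)⁻¹) (ENNReal.ofReal p.conjExponent) (volume.restrict (Ioo 0 c)) *
      eLpNorm v₀ (ENNReal.ofReal p) (volume.restrict (Ioo 0 c)) = ∞ ∧
    eLpNorm (fun x => (v₁ x)⁻¹) (ENNReal.ofReal p.conjExponent) (volume.restrict (Ioi c)) *
      eLpNorm v₀ (ENNReal.ofReal p) (volume.restrict (Ioi c)) = ∞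

/-- The density `v₁ ^ (-p')`. -/
noncomputable def dens (p : ℝ) (v₁ : ℝ → ℝ) (x : ℝ) : ℝ := v₁ x ^ (-p.conjExponent)

/-- `0 < α < t < β < ∞`, the equilibrium condition `∫_α^t v₁^{-p'} = ∫_t^β v₁^{-p'}`, and the
normalization `(∫_α^β v₁^{-p'})^{1/p'} (∫_α^β v₀^p)^{1/p} = 1`. -/
structure IsOinarovOtelbaev (p : ℝ) (v₀ v₁ : ℝ → ℝ) (t α β : ℝ) : Prop where
  pos : 0 < α
  left_lt : α < t
  lt_right : t < β
  equilibrium : ∫ x in α..t, dens p v₁ x = ∫ x in t..β, dens p v₁ x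
  normalized : (∫ x in α..β, dens p v₁ x) ^ (1 / p.conjExponent) *
    (∫ x in α..β, v₀ x ^ p) ^ (1 / p) = 1

/-- The pair `(a(t), b(t))` determined by the equilibrium condition and the normalization.
For weights with `1 / v₁ ∈ L^{p'}_loc` and the endpoint condition, such a pair exists and is unique
for every `t > 0`. -/
noncomputable def abPair (p : ℝ) (v₀ v₁ : ℝ → ℝ) (t : ℝ) : ℝ × ℝ :=
  Classical.epsilon (fun q : ℝ × ℝ => IsOinarovOtelbaev p v₀ v₁ t q.1 q.2)

/-- The function `a(t)`. -/
noncomputable def aFun (p : ℝ) (v₀ v₁ : ℝ → ℝ) (t : ℝ) : ℝ := (abPair p v₀ v₁ t).1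

/-- The function `b(t)`. -/
noncomputable def bFun (p : ℝ) (v₀ v₁ : ℝ → ℝ) (t : ℝ) : ℝ := (abPair p v₀ v₁ t).2

/-- `V₁(t) = ∫_{a(t)}^{b(t)} v₁^{-p'}`. -/
noncomputable def V1 (p : ℝ) (v₀ v₁ : ℝ → ℝ) (t : ℝ) : ℝ :=
  ∫ x in aFun p v₀ v₁ t..bFun p v₀ v₁ t, dens p v₁ x

/-- The interval `(t, a⁻¹(t))` for an increasing function `a` and `t > 0`. When `t` lies above the
range of `a`, the interval is `(t, ∞)`, that is, `a⁻¹(t) = ∞`. -/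
def toInv (a : ℝ → ℝ) (t : ℝ) : Set ℝ := {x | t < x ∧ a x < t}

theorem toInv_eq_Ioo {a : ℝ → ℝ} (ha : StrictMonoOn a (Ioi 0)) {s t : ℝ} (ht : 0 < t)
    (hs : 0 < s) (hst : a s = t) : toInv a t = Ioo t s := by
  ext x
  simp only [toInv, mem_ofPred_eq, mem_Ioo]
  refine and_congr_right fun hx => ?_
  rw [← hst]
  exact ha.lt_iff_lt (ht.trans hx) hs

/-- `𝔾(g) = (∫_0^∞ v₁^{-p'}(t) |∫_t^{a⁻¹(t)} (g(x)/V₁(x)) (∫_{a(x)}^t v₁^{-p'}) dx|^{p'} dt)^{1/p'}`. -/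
noncomputable def bbG (p : ℝ) (v₀ v₁ : ℝ → ℝ) (g : ℝ → ℝ) : ℝ≥0∞ :=
  (∫⁻ t in Ioi (0 : ℝ), ENNReal.ofReal (dens p v₁ t *
    |∫ x in toInv (aFun p v₀ v₁) t,
      g x / V1 p v₀ v₁ x * ∫ y in aFun p v₀ v₁ x..t, dens p v₁ y| ^ p.conjExponent)) ^
    (1 / p.conjExponent)

/-- `𝒢(g) = (∫_0^∞ v₁^{-p'}(t) V₁^{p'}(t) |∫_t^{a⁻¹(t)} g(x)/V₁(x) dx|^{p'} dt)^{1/p'}`. -/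
noncomputable def calG (p : ℝ) (v₀ v₁ : ℝ → ℝ) (g : ℝ → ℝ) : ℝ≥0∞ :=
  (∫⁻ t in Ioi (0 : ℝ), ENNReal.ofReal (dens p v₁ t * V1 p v₀ v₁ t ^ p.conjExponent *
    |∫ x in toInv (aFun p v₀ v₁) t, g x / V1 p v₀ v₁ x| ^ p.conjExponent)) ^
    (1 / p.conjExponent)

/-- `G(g) = (∫_0^∞ (∫_t^{a⁻¹(t)} |g(x)| dx)^{p'} v₁^{-p'}(t) dt)^{1/p'}`. -/
noncomputable def sfG (p : ℝ) (v₀ v₁ : ℝ → ℝ) (g : ℝ → ℝ) : ℝ≥0∞ :=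
  (∫⁻ t in Ioi (0 : ℝ), (∫⁻ x in toInv (aFun p v₀ v₁) t, ‖g x‖ₑ) ^ p.conjExponent *
    ENNReal.ofReal (dens p v₁ t)) ^ (1 / p.conjExponent)

/-- The space `𝕎_{p',1/v₁}` of all `g ∈ L¹_loc(0,∞)` with `G(g) < ∞`. -/
def bbW (p : ℝ) (v₀ v₁ : ℝ → ℝ) : Set (ℝ → ℝ) :=
  {g | LocallyIntegrableOn g (Ioi 0) volume ∧ sfG p v₀ v₁ g < ∞}

/-- The norm `‖g‖_𝒲 = 𝔾(g) + 𝒢(g)` of `𝒲_{p',1/v₁}`. -/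
noncomputable def scrWNorm (p : ℝ) (v₀ v₁ : ℝ → ℝ) (g : ℝ → ℝ) : ℝ≥0∞ :=
  bbG p v₀ v₁ g + calG p v₀ v₁ g

end WeightedSobolev

/-! The two parts of the norm put the absolute value outside the integral over `(t, a⁻¹(t))`, so
they see cancellation in `g`. Multiplying `h` on `[c,d]` by a rapidly oscillating sign keeps `|g| =
|h|` and makes these inner integrals small.

With `F` a primitive of `v₁^{-p'}`, the kernel of `𝔾` is `F(t) - F(a(x))`. Hence every inner
integral is a combination of integrals over intervals of two fixed integrable functions, `h/V₁` and
`h·F(a)/V₁`, against the sign, with coefficients depending on `t` only. A Riemann–Lebesgue lemma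
uniform over all intervals (`eventually_integral_squareWave_le`) makes them at most `δ` for all `t`
at once. The interval for `t` meets `[c,d]` only when `a(c) < t < d`; there `F` and `V₁` are bounded
and `v₁^{-p'}` is integrable, so the norm is `O(δ)`.

This needs `a` and `b` to exist and be increasing. Existence is an intermediate value argument
(`exists_balanced`); monotonicity holds because normalized intervals cannot be strictly nested
(`IsBalanced.lt_lt`). The normalization also keeps `V₁` away from zero on `[c,d]` (`exists_le_V1`).
-/

namespace WeightedSobolev

open Filter Topology

/-! ### Square waves and a uniform Riemann–Lebesgue lemma -/

/-- The square wave of half-period `η` with values `±1`. -/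
noncomputable def squareWave (η x : ℝ) : ℝ := (-1 : ℝ) ^ ⌊x / η⌋

theorem abs_squareWave (η x : ℝ) : |squareWave η x| = 1 := by
  rw [squareWave, abs_zpow, abs_neg, abs_one, one_zpow]

theorem measurable_squareWave (η : ℝ) : Measurable (squareWave η) :=
  (measurable_from_top (f := fun n : ℤ => (-1 : ℝ) ^ n)).comp
    (Int.measurable_floor.comp (measurable_id.div_const η))

theorem squareWave_add {η : ℝ} (hη : 0 < η) (x : ℝ) :
    squareWave η (x + η) = -squareWave η x := by
  have : (x + η) / η = x / η + 1 := by field_simp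
  rw [squareWave, this, Int.floor_add_one, zpow_add_one₀ (by norm_num), squareWave]
  ring

theorem integrable_mul_squareWave {μ : Measure ℝ} {f : ℝ → ℝ}
    (hf : Integrable f μ) (η : ℝ) : Integrable (fun x => f x * squareWave η x) μ :=
  hf.mul_bdd (c := 1) (measurable_squareWave η).aestronglyMeasurable
    (Eventually.of_forall fun x => (abs_squareWave η x).le)

theorem abs_integral_mul_squareWave_le (μ : Measure ℝ) (f : ℝ → ℝ) (η : ℝ) :
    |∫ x, f x * squareWave η x ∂μ| ≤ ∫ x, |f x| ∂μ := by
  refine (abs_integral_le_integral_abs).trans_eq ?_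
  simp only [abs_mul, abs_squareWave, mul_one]

/-- Integration against a square wave is controlled by the modulus of continuity in `L¹`. -/
theorem two_mul_abs_integral_mul_squareWave_le {f : ℝ → ℝ} (hf : Integrable f) {η : ℝ}
    (hη : 0 < η) :
    2 * |∫ x, f x * squareWave η x| ≤ ∫ x, |f x - f (x + η)| := by
  -- Translating by the half-period preserves the integral and flips the sign of the wave.
  have h1 : ∫ x, f (x + η) * squareWave η x = -∫ x, f x * squareWave η x := by
    rw [← integral_add_right_eq_self (fun x => f x * squareWave η x) η, ← integral_neg]
    simp [squareWave_add hη]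
  have h2 : ∫ x, (f x - f (x + η)) * squareWave η x = 2 * ∫ x, f x * squareWave η x := by
    simp_rw [sub_mul]
    rw [integral_sub (integrable_mul_squareWave hf η)
      (integrable_mul_squareWave (hf.comp_add_right η) η), h1]
    ring
  have h3 := abs_integral_mul_squareWave_le volume (fun x => f x - f (x + η)) η
  rwa [h2, abs_mul, abs_two] at h3

/-- Two points of either set more than `η` apart would trap a point outside `I` between two points
of `I`, so each set has diameter at most `η`. The bound does not depend on `I`, whence the later
uniformity. -/
theorem volume_exit_le {I : Set ℝ} (hI : I.OrdConnected) {η : ℝ} (hη : 0 < η) :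
    volume {x | x ∈ I ∧ x + η ∉ I} ≤ ENNReal.ofReal η ∧
      volume {x | x ∉ I ∧ x + η ∈ I} ≤ ENNReal.ofReal η := by
  have key : ∀ S : Set ℝ, (∀ x ∈ S, ∀ y ∈ S, x ≤ y → y - x ≤ η) →
      volume S ≤ ENNReal.ofReal η := by
    intro S hS
    refine (Real.volume_le_diam S).trans (Metric.ediam_le fun x hx y hy => ?_)
    rw [edist_dist, Real.dist_eq]
    refine ENNReal.ofReal_le_ofReal (abs_sub_le_iff.2 ⟨?_, ?_⟩)
    · rcases le_total x y with h | h
      · linarith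
      · exact hS y hy x hx h
    · rcases le_total x y with h | h
      · exact hS x hx y hy h
      · linarith
  refine ⟨key _ fun x hx y hy _ => ?_, key _ fun x hx y hy _ => ?_⟩
  · by_contra! hlt
    exact hx.2 (hI.out hx.1 hy.1 ⟨by linarith, by linarith⟩)
  · by_contra! hlt
    exact hy.1 (hI.out hx.2 hy.2 ⟨by linarith, by linarith⟩)

/-- The function `1_I ψ` changes little under a shift by `η`: where both points lie in `I`, uniform
continuity gives `ω` on a bounded set; where exactly one does, the change is at most `C`, on a set
of measure at most `2η`. -/
theorem eventually_integral_squareWave_le_of_continuous {ψ : ℝ → ℝ} (hc : Continuous ψ)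
    (hs : HasCompactSupport ψ) {δ : ℝ} (hδ : 0 < δ) :
    ∀ᶠ η in 𝓝[>] (0 : ℝ), ∀ I : Set ℝ, I.OrdConnected →
      |∫ x in I, ψ x * squareWave η x| ≤ δ := by
  obtain ⟨C, hC⟩ := hc.bounded_above_of_compact_support hs
  have hC0 : 0 ≤ C := (norm_nonneg _).trans (hC 0)
  obtain ⟨M, hM0, hM⟩ : ∃ M : ℝ, 0 < M ∧ tsupport ψ ⊆ Icc (-M) M := by
    obtain ⟨R, hR⟩ := hs.isBounded.subset_closedBall 0
    refine ⟨max R 1, by positivity, hR.trans ?_⟩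
    rw [Real.closedBall_eq_Icc]
    exact Icc_subset_Icc (by simp) (by simp)
  -- Here `2M + 1` is the length of `J = [-M-1, M]`; for `η < 1` both `x` and `x + η` miss the
  -- support when `x ∉ J`.
  obtain ⟨ω, hω, hωM⟩ : ∃ ω : ℝ, 0 < ω ∧ ω * (2 * M + 1) ≤ δ :=
    ⟨δ / (2 * M + 1), by positivity, by field_simp; rfl⟩
  obtain ⟨e, he, hunif⟩ := Metric.uniformContinuous_iff.1
    (hs.uniformContinuous_of_continuous hc) ω hω
  have h1 : ∀ᶠ η in 𝓝[>] (0 : ℝ), η < min (min e 1) (δ / (2 * C + 1)) :=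
    nhdsWithin_le_nhds (eventually_lt_nhds (by positivity))
  filter_upwards [h1, self_mem_nhdsWithin] with η hη hη0 I hI
  replace hη0 : 0 < η := hη0
  simp only [lt_min_iff] at hη
  obtain ⟨⟨hηe, hη1⟩, hηC⟩ := hη
  have hCη : 2 * (C * η) ≤ δ := by
    rw [lt_div_iff₀ (by positivity)] at hηC
    nlinarith
  have hIm : MeasurableSet I := hI.measurableSet
  have hψ : Integrable ψ := hc.integrable_of_hasCompactSupport hs
  set f : ℝ → ℝ := I.indicator ψ with hf
  have hfi : Integrable f := hψ.indicator hIm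
  have heq : ∫ x in I, ψ x * squareWave η x = ∫ x, f x * squareWave η x := by
    rw [← integral_indicator hIm]
    refine integral_congr_ae (Eventually.of_forall fun x => ?_)
    by_cases hx : x ∈ I <;> simp [hf, hx]
  have hmt : Measurable fun x : ℝ => x + η := measurable_id.add_const η
  set S₁ : Set ℝ := {x | x ∈ I ∧ x + η ∉ I} with hS₁
  set S₂ : Set ℝ := {x | x ∉ I ∧ x + η ∈ I} with hS₂
  have hS₁m : MeasurableSet S₁ := hIm.inter (hmt hIm).compl
  have hS₂m : MeasurableSet S₂ := hIm.compl.inter (hmt hIm)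
  obtain ⟨hv₁, hv₂⟩ := volume_exit_le hI hη0
  set J : Set ℝ := Icc (-M - 1) M with hJ
  have hpt : ∀ x, |f x - f (x + η)| ≤
      J.indicator (fun _ => ω) x + (S₁.indicator (fun _ => C) x + S₂.indicator (fun _ => C) x) := by
    intro x
    have hJ0 : 0 ≤ J.indicator (fun _ => ω) x := indicator_nonneg (fun _ _ => hω.le) x
    by_cases hx : x ∈ I <;> by_cases hxη : x + η ∈ I
    · have e1 : x ∉ S₁ := fun h => h.2 hxη
      have e2 : x ∉ S₂ := fun h => h.1 hx
      simp only [hf, indicator_of_mem hx, indicator_of_mem hxη, indicator_of_notMem e1,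
        indicator_of_notMem e2, add_zero]
      by_cases hxJ : x ∈ J
      · rw [indicator_of_mem hxJ]
        have := @hunif x (x + η) (by rw [Real.dist_eq]; simpa [abs_of_pos hη0] using hηe)
        rw [Real.dist_eq] at this
        exact this.le
      · have z1 : ψ x = 0 := image_eq_zero_of_notMem_tsupport fun h =>
          hxJ ⟨by linarith [(hM h).1], (hM h).2⟩
        have z2 : ψ (x + η) = 0 := image_eq_zero_of_notMem_tsupport fun h =>
          hxJ ⟨by linarith [(hM h).1], by linarith [(hM h).2]⟩
        simpa [z1, z2] using hJ0
    · have e1 : x ∈ S₁ := ⟨hx, hxη⟩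
      have e2 : x ∉ S₂ := fun h => h.1 hx
      simp only [hf, indicator_of_mem hx, indicator_of_notMem hxη, indicator_of_mem e1,
        indicator_of_notMem e2, add_zero, sub_zero]
      have := hC x
      rw [Real.norm_eq_abs] at this
      linarith
    · have e1 : x ∉ S₁ := fun h => h.2 hxη
      have e2 : x ∈ S₂ := ⟨hx, hxη⟩
      simp only [hf, indicator_of_notMem hx, indicator_of_mem hxη, indicator_of_notMem e1,
        indicator_of_mem e2, zero_add, zero_sub, abs_neg]
      have := hC (x + η)
      rw [Real.norm_eq_abs] at this
      linarith
    · have e1 : x ∉ S₁ := fun h => hx h.1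
      have e2 : x ∉ S₂ := fun h => hxη h.2
      simpa [hf, hx, hxη, e1, e2] using hJ0
  have i1 : Integrable (J.indicator fun _ => ω) :=
    (integrable_indicator_iff measurableSet_Icc).2 (integrableOn_const (by simp))
  have i2 : Integrable (S₁.indicator fun _ => C) :=
    (integrable_indicator_iff hS₁m).2
      (integrableOn_const (hv₁.trans_lt ENNReal.ofReal_lt_top).ne)
  have i3 : Integrable (S₂.indicator fun _ => C) :=
    (integrable_indicator_iff hS₂m).2
      (integrableOn_const (hv₂.trans_lt ENNReal.ofReal_lt_top).ne)
  have hle := integral_mono ((hfi.sub (hfi.comp_add_right η)).abs) (i1.add (i2.add i3)) hpt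
  have r1 : volume.real S₁ ≤ η := ENNReal.toReal_le_of_le_ofReal hη0.le hv₁
  have r2 : volume.real S₂ ≤ η := ENNReal.toReal_le_of_le_ofReal hη0.le hv₂
  have r3 : volume.real J = 2 * M + 1 := by
    rw [hJ, Real.volume_real_Icc_of_le (by linarith)]; ring
  have hsum : ∫ x, (J.indicator (fun _ => ω) + (S₁.indicator (fun _ => C) +
      S₂.indicator (fun _ => C))) x = (2 * M + 1) * ω + (volume.real S₁ * C + volume.real S₂ * C) := by
    rw [integral_add' i1 (i2.add i3), integral_add' i2 i3, integral_indicator_const _ measurableSet_Icc,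
      integral_indicator_const _ hS₁m, integral_indicator_const _ hS₂m, ← hJ, r3]
    simp
  rw [hsum] at hle
  have h2 := two_mul_abs_integral_mul_squareWave_le hfi hη0
  rw [heq]
  have h3 := h2.trans hle
  nlinarith [mul_le_mul_of_nonneg_right r1 hC0, mul_le_mul_of_nonneg_right r2 hC0]

/-- A Riemann–Lebesgue lemma for square waves, uniform over all intervals. -/
theorem eventually_integral_squareWave_le {φ : ℝ → ℝ} (hφ : Integrable φ) {δ : ℝ} (hδ : 0 < δ) :
    ∀ᶠ η in 𝓝[>] (0 : ℝ), ∀ I : Set ℝ, I.OrdConnected →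
      |∫ x in I, φ x * squareWave η x| ≤ δ := by
  obtain ⟨ψ, hs, hψ, hc, hψi⟩ :=
    hφ.exists_hasCompactSupport_integral_sub_le (half_pos hδ)
  filter_upwards [eventually_integral_squareWave_le_of_continuous hc hs (half_pos hδ)]
    with η hη I hI
  have h1 : ∫ x in I, φ x * squareWave η x =
      (∫ x in I, (φ x - ψ x) * squareWave η x) + ∫ x in I, ψ x * squareWave η x := by
    have i1 : Integrable (fun x => φ x - ψ x) (volume.restrict I) := (hφ.sub hψi).integrableOn
    rw [← integral_add (integrable_mul_squareWave i1 η)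
      (integrable_mul_squareWave hψi.integrableOn η)]
    congr 1 with x
    ring
  -- The wave has modulus one, so the approximation error is bounded by the `L¹` distance, whatever
  -- `I` and `η` are.
  have h2 : |∫ x in I, (φ x - ψ x) * squareWave η x| ≤ δ / 2 :=
    ((abs_integral_mul_squareWave_le _ _ η).trans
      (setIntegral_le_integral (hφ.sub hψi).abs (Eventually.of_forall fun _ => abs_nonneg _))).trans hψ
  rw [h1]
  exact (abs_add_le _ _).trans (by linarith [hη I hI])

/-! ### Balanced intervals: existence and monotonicity -/

/-- `α` and `β` are symmetric around `t` with respect to the increasing function `F`, and the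
increments of `F` and `W` over `[α, β]` satisfy the normalization. -/
structure IsBalanced (q r : ℝ) (F W : ℝ → ℝ) (t α β : ℝ) : Prop where
  pos : 0 < α
  left_lt : α < t
  lt_right : t < β
  symm : F t - F α = F β - F t
  normalized : (F β - F α) ^ q * (W β - W α) ^ r = 1

section Balanced

variable {q r : ℝ} {F W : ℝ → ℝ}

/-- Shrink `[α,β]` to `t` through intervals symmetric with respect to `F`: the normalized product
varies continuously from a value at least `1` down to `0`. -/
theorem exists_balanced_of_one_le (hq : 0 < q) (hr : 0 < r)
    (hF : StrictMonoOn F (Ioi 0)) (hFc : ContinuousOn F (Ioi 0)) (hWc : ContinuousOn W (Ioi 0))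
    {t α β : ℝ} (hα : 0 < α) (hαt : α < t) (htβ : t < β) (hsymm : F t - F α = F β - F t)
    (h1 : 1 ≤ (F β - F α) ^ q * (W β - W α) ^ r) :
    ∃ α' β', IsBalanced q r F W t α' β' := by
  have ht : 0 < t := hα.trans hαt
  have hsub : Icc t β ⊆ Ioi 0 := fun x hx => ht.trans_le hx.1
  have hsub' : Icc α t ⊆ Ioi 0 := fun x hx => hα.trans_le hx.1
  have hmaps : MapsTo F (Icc t β) (Icc (F t) (F β)) := fun x hx =>
    ⟨hF.monotoneOn ht (hsub hx) hx.1, hF.monotoneOn (hsub hx) (ht.trans htβ) hx.2⟩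
  let f : Icc t β → Icc (F t) (F β) := hmaps.restrict
  have hfm : StrictMono f := fun x y hxy => hF (hsub x.2) (hsub y.2) hxy
  have hfs : Function.Surjective f := by
    rintro ⟨y, hy⟩
    obtain ⟨x, hx, hxy⟩ := intermediate_value_Icc htβ.le (hFc.mono hsub) hy
    exact ⟨⟨x, hx⟩, Subtype.ext hxy⟩
  -- An order isomorphism is a homeomorphism, so the right endpoint `G x` depends continuously on
  -- the left one.
  let e := hfm.orderIsoOfSurjective f hfs
  have he : ∀ y, F (e.symm y) = y := fun y => congrArg Subtype.val (e.apply_symm_apply y)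
  have hmem : ∀ x : Icc α t, 2 * F t - F x ∈ Icc (F t) (F β) := fun x =>
    ⟨by linarith [hF.monotoneOn (hsub' x.2) ht x.2.2],
      by linarith [hF.monotoneOn hα (hsub' x.2) x.2.1]⟩
  let G : Icc α t → ℝ := fun x => (e.symm ⟨2 * F t - F x, hmem x⟩ : Icc t β)
  have hFα : Continuous fun x : Icc α t => F x := continuousOn_iff_continuous_domRestrict.1 (hFc.mono hsub')
  have hWα : Continuous fun x : Icc α t => W x := continuousOn_iff_continuous_domRestrict.1 (hWc.mono hsub')
  have hG : Continuous G := continuous_subtype_val.comp (e.symm.continuous.comp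
    ((continuous_const.sub hFα).subtype_mk _))
  have hGmem : ∀ x, G x ∈ Icc t β := fun x => (e.symm ⟨2 * F t - F x, hmem x⟩).2
  have hFG : ∀ x, F (G x) = 2 * F t - F x := fun x => he ⟨2 * F t - F x, hmem x⟩
  have hWG : Continuous fun x => W (G x) :=
    hWc.comp_continuous hG fun x => hsub (hGmem x)
  let Φ : Icc α t → ℝ := fun x => (2 * F t - F x - F x) ^ q * (W (G x) - W x) ^ r
  have hΦ : Continuous Φ :=
    (((continuous_const.sub hFα).sub hFα).rpow_const fun _ => Or.inr hq.le).mul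
      ((hWG.sub hWα).rpow_const fun _ => Or.inr hr.le)
  let x₀ : Icc α t := ⟨α, le_rfl, hαt.le⟩
  let x₁ : Icc α t := ⟨t, hαt.le, le_rfl⟩
  have hG0 : G x₀ = β := hF.injOn (hsub (hGmem x₀)) (ht.trans htβ)
    (by rw [hFG]; change 2 * F t - F α = F β; linarith)
  have hΦ0 : 1 ≤ Φ x₀ := by
    change 1 ≤ (2 * F t - F α - F α) ^ q * (W (G x₀) - W α) ^ r
    rw [hG0]
    convert h1 using 3
    linarith
  have hΦ1 : Φ x₁ = 0 := by
    change (2 * F t - F t - F t) ^ q * (W (G x₁) - W t) ^ r = 0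
    rw [show 2 * F t - F t - F t = 0 by ring, Real.zero_rpow hq.ne', zero_mul]
  have : PreconnectedSpace (Icc α t) := Subtype.preconnectedSpace isPreconnected_Icc
  obtain ⟨x, hx⟩ := mem_range_of_exists_le_of_exists_ge hΦ ⟨x₁, hΦ1.le.trans zero_le_one⟩ ⟨x₀, hΦ0⟩
  have hxt : (x : ℝ) < t := by
    refine lt_of_le_of_ne x.2.2 fun h => ?_
    rw [show x = x₁ from Subtype.ext h, hΦ1] at hx
    exact zero_ne_one hx
  have hFxt : F x < F t := hF (hsub' x.2) ht hxt
  refine ⟨x, G x, hα.trans_le x.2.1, hxt, lt_of_le_of_ne (hGmem x).1 fun h => ?_, ?_, ?_⟩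
  · have := hFG x
    rw [← h] at this
    linarith
  · rw [hFG]; ring
  · rw [hFG]; exact hx

theorem exists_one_le_rpow_mul {q k : ℝ} (hq : 0 < q) (hk : 0 < k) :
    ∃ N : ℝ, 0 ≤ N ∧ ∀ x, N ≤ x → 1 ≤ x ^ q * k := by
  obtain ⟨N, hN⟩ := eventually_atTop.1 ((tendsto_rpow_atTop hq).eventually_ge_atTop (1 / k))
  refine ⟨max N 0, le_max_right _ _, fun x hx => ?_⟩
  have := hN x ((le_max_left _ _).trans hx)
  rwa [div_le_iff₀ hk] at this

theorem rpow_mul_rpow_le {q r x x' y y' : ℝ} (hq : 0 < q) (hr : 0 < r) (hx : 0 ≤ x) (hxx : x ≤ x')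
    (hy : 0 ≤ y) (hyy : y ≤ y') : x ^ q * y ^ r ≤ x' ^ q * y' ^ r :=
  mul_le_mul (Real.rpow_le_rpow hx hxx hq.le) (Real.rpow_le_rpow hy hyy hr.le)
    (Real.rpow_nonneg hy _) (Real.rpow_nonneg (hx.trans hxx) _)

/-- It suffices to find a symmetric interval whose product is at least `1`. If every `α < t` has a
symmetric partner, let `α` tend to `0`: one increment blows up while the other stays bounded below.
If some `α₀` has none, `F` is bounded at infinity, so `W` is not; a large `β` then has a partner in
`(α₀, t)`. -/
theorem exists_balanced (hq : 0 < q) (hr : 0 < r)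
    (hF : StrictMonoOn F (Ioi 0)) (hFc : ContinuousOn F (Ioi 0))
    (hW : MonotoneOn W (Ioi 0)) (hWc : ContinuousOn W (Ioi 0))
    (h0 : Tendsto F (𝓝[>] 0) atBot ∨ Tendsto W (𝓝[>] 0) atBot)
    (hinf : Tendsto F atTop atTop ∨ Tendsto W atTop atTop)
    (hne : ∃ x y, 0 < x ∧ x < y ∧ W x < W y) {t : ℝ} (ht : 0 < t) :
    ∃ α β, IsBalanced q r F W t α β := by
  suffices h : ∃ α β, 0 < α ∧ α < t ∧ t < β ∧ F t - F α = F β - F t ∧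
      1 ≤ (F β - F α) ^ q * (W β - W α) ^ r by
    obtain ⟨α, β, hα, hαt, htβ, hs, h1⟩ := h
    exact exists_balanced_of_one_le hq hr hF hFc hWc hα hαt htβ hs h1
  by_cases hcase : ∀ α, 0 < α → α < t → ∃ β, t < β ∧ F β = 2 * F t - F α
  · rcases h0 with h0 | h0
    · obtain ⟨x, y, hx, hxy, hWxy⟩ := hne
      obtain ⟨N, hN0, hN⟩ := exists_one_le_rpow_mul hq (Real.rpow_pos_of_pos (sub_pos.2 hWxy) r)
      have hy : 0 < y := hx.trans hxy
      have ev : ∀ᶠ α in 𝓝[>] (0 : ℝ), 0 < α ∧ α < t ∧ α < x ∧ F α ≤ F t - N ∧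
          F α ≤ 2 * F t - F y := by
        filter_upwards [self_mem_nhdsWithin, nhdsWithin_le_nhds (eventually_lt_nhds ht),
          nhdsWithin_le_nhds (eventually_lt_nhds hx), h0.eventually_le_atBot (F t - N),
          h0.eventually_le_atBot (2 * F t - F y)] with α h1 h2 h3 h4 h5
        exact ⟨h1, h2, h3, h4, h5⟩
      obtain ⟨α, hα, hαt, hαx, hαN, hαy⟩ := ev.exists
      obtain ⟨β, htβ, hβ⟩ := hcase α hα hαt
      -- Once `F α` is low enough the interval swallows `[x,y]`, so the increment of `W` is at least
      -- `W y - W x`.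
      have hyβ : y ≤ β := (hF.le_iff_le hy (ht.trans htβ)).1 (by linarith)
      refine ⟨α, β, hα, hαt, htβ, by linarith, (hN (F β - F α) (by
        have := hF hα ht hαt; linarith)).trans ?_⟩
      have w1 := hW hα hx hαx.le
      have w2 := hW hy (ht.trans htβ) hyβ
      have w3 := hF hα ht hαt
      exact rpow_mul_rpow_le hq hr (by linarith) le_rfl (by linarith) (by linarith)
    · have hFt : 0 < F t - F (t / 2) := sub_pos.2 (hF (half_pos ht) ht (half_lt_self ht))
      obtain ⟨N, hN0, hN⟩ := exists_one_le_rpow_mul hr (Real.rpow_pos_of_pos hFt q)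
      have ev : ∀ᶠ α in 𝓝[>] (0 : ℝ), 0 < α ∧ α < t / 2 ∧ W α ≤ W t - N := by
        filter_upwards [self_mem_nhdsWithin, nhdsWithin_le_nhds (eventually_lt_nhds (half_pos ht)),
          h0.eventually_le_atBot (W t - N)] with α h1 h2 h3
        exact ⟨h1, h2, h3⟩
      obtain ⟨α, hα, hαt, hαN⟩ := ev.exists
      obtain ⟨β, htβ, hβ⟩ := hcase α hα (hαt.trans (half_lt_self ht))
      refine ⟨α, β, hα, hαt.trans (half_lt_self ht), htβ, by linarith,
        (hN (W t - W α) (by linarith)).trans ?_⟩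
      have w1 := hF hα (half_pos ht) hαt
      have w2 := hW ht (ht.trans htβ) htβ.le
      have w3 := hF ht (ht.trans htβ) htβ
      rw [mul_comm]
      exact rpow_mul_rpow_le hq hr hFt.le (by linarith) (by linarith) (by linarith)
  · push Not at hcase
    obtain ⟨α₀, hα₀, hα₀t, hno⟩ := hcase
    have hFα₀ := hF hα₀ ht hα₀t
    have hlt : ∀ β, t < β → F β < 2 * F t - F α₀ := by
      intro β htβ
      by_contra! hge
      have hsub : Icc t β ⊆ Ioi 0 := fun x hx => ht.trans_le hx.1
      obtain ⟨x, hx, hxe⟩ := intermediate_value_Icc htβ.le (hFc.mono hsub)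
        (⟨by linarith, hge⟩ : 2 * F t - F α₀ ∈ Icc (F t) (F β))
      refine hno x (lt_of_le_of_ne hx.1 fun h => ?_) hxe
      rw [← h] at hxe
      linarith
    have hWinf : Tendsto W atTop atTop := by
      refine hinf.resolve_left fun hFinf => ?_
      obtain ⟨β, h1, h2⟩ := ((hFinf.eventually_ge_atTop (2 * F t - F α₀)).and
        (eventually_gt_atTop t)).exists
      exact absurd (hlt β h2) (not_lt.2 h1)
    have hFt : 0 < F (t + 1) - F t := sub_pos.2 (hF ht (by simp; linarith) (by linarith))
    obtain ⟨N, hN0, hN⟩ := exists_one_le_rpow_mul hr (Real.rpow_pos_of_pos hFt q)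
    obtain ⟨β, h1, h2⟩ := ((hWinf.eventually_ge_atTop (W t + N)).and
        (eventually_gt_atTop (t + 1))).exists
    have htβ : t < β := by linarith
    have hFβ := hF ht (ht.trans htβ) htβ
    obtain ⟨α, hα, hαe⟩ := intermediate_value_Icc hα₀t.le
      (hFc.mono fun x hx => hα₀.trans_le hx.1)
      (⟨by linarith [hlt β htβ], by linarith⟩ : 2 * F t - F β ∈ Icc (F α₀) (F t))
    have hα0 : 0 < α := hα₀.trans_le hα.1
    have hαt : α < t := by
      refine lt_of_le_of_ne hα.2 fun h => ?_
      rw [h] at hαe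
      linarith
    refine ⟨α, β, hα0, hαt, htβ, by linarith, (hN (W β - W t) (by linarith)).trans ?_⟩
    have w1 := hF (show t + 1 ∈ Ioi (0 : ℝ) by simp; linarith) (ht.trans htβ) h2
    have w2 := hW hα0 ht hαt.le
    rw [mul_comm]
    exact rpow_mul_rpow_le hq hr hFt.le (by linarith) (by linarith) (by linarith)

/-- Two normalized intervals cannot be nested with strictly different increments of `F`. -/
theorem IsBalanced.not_nested (hq : 0 < q) (hr : 0 < r) (hW : MonotoneOn W (Ioi 0))
    {t α β t' α' β' : ℝ} (h : IsBalanced q r F W t α β) (h' : IsBalanced q r F W t' α' β')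
    (hF0 : F α ≤ F β)
    (hα : α' ≤ α) (hβ : β ≤ β') (hlt : F β - F α < F β' - F α') : False := by
  have p1 := h.pos
  have p1' := h'.pos
  have l1 := h.left_lt
  have l2 := h.lt_right
  have w1 := hW p1' p1 hα
  have w2 := hW (p1.trans (l1.trans l2)) (p1.trans_le ((l1.trans l2).le.trans hβ)) hβ
  have w3 := hW p1 (p1.trans (l1.trans l2)) (l1.trans l2).le
  have hWpos : 0 < (W β - W α) ^ r := by
    refine lt_of_le_of_ne (Real.rpow_nonneg (by linarith) _) fun h0 => ?_
    have := h.normalized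
    rw [← h0, mul_zero] at this
    exact zero_ne_one this
  have e1 : (F β - F α) ^ q < (F β' - F α') ^ q := Real.rpow_lt_rpow (by linarith) hlt hq
  have e2 : (W β - W α) ^ r ≤ (W β' - W α') ^ r :=
    Real.rpow_le_rpow (by linarith) (by linarith) hr.le
  have := mul_lt_mul e1 e2 hWpos (Real.rpow_nonneg (by linarith) _)
  rw [h.normalized, h'.normalized] at this
  exact lt_irrefl _ this

/-- If one endpoint failed to move right, symmetry about the larger centre would force the other to
move right, making the intervals nested with different `F`-increments. -/
theorem IsBalanced.lt_lt (hq : 0 < q) (hr : 0 < r)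
    (hF : StrictMonoOn F (Ioi 0)) (hW : MonotoneOn W (Ioi 0))
    {t α β t' α' β' : ℝ} (h : IsBalanced q r F W t α β) (h' : IsBalanced q r F W t' α' β')
    (ht : t < t') : α < α' ∧ β < β' := by
  have a0 := h.pos
  have a0' := h'.pos
  have t0 : 0 < t := a0.trans h.left_lt
  have t0' : 0 < t' := a0'.trans h'.left_lt
  have b0 : 0 < β := t0.trans h.lt_right
  have b0' : 0 < β' := t0'.trans h'.lt_right
  have e := h.symm
  have e' := h'.symm
  have f1 := hF t0 t0' ht
  have f2 := hF a0 b0 (h.left_lt.trans h.lt_right)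
  have f3 := hF a0' b0' (h'.left_lt.trans h'.lt_right)
  constructor
  · by_contra! hle
    have f4 := hF.monotoneOn a0' a0 hle
    have hβ : β ≤ β' := (hF.le_iff_le b0 b0').1 (by linarith)
    exact h.not_nested hq hr hW h' f2.le hle hβ (by linarith)
  · by_contra! hle
    have f4 := hF.monotoneOn b0' b0 hle
    have hα : α ≤ α' := (hF.le_iff_le a0 a0').1 (by linarith)
    exact h'.not_nested hq hr hW h f3.le hα hle (by linarith)

end Balanced

/-! ### Primitives of locally integrable functions on the half-line -/

/-- The primitive of `f` on `(0,∞)` vanishing at `1`. -/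
noncomputable def primit (f : ℝ → ℝ) (x : ℝ) : ℝ := ∫ y in (1 : ℝ)..x, f y

section Primitive

variable {f : ℝ → ℝ}

theorem integrableOn_Icc_of_pos (hf : LocallyIntegrableOn f (Ioi 0)) {x : ℝ} (hx : 0 < x) (y : ℝ) :
    IntegrableOn f (Icc x y) :=
  hf.integrableOn_compact_subset (fun _ hz => hx.trans_le hz.1) isCompact_Icc

theorem intervalIntegrable_of_pos (hf : LocallyIntegrableOn f (Ioi 0)) {x y : ℝ} (hx : 0 < x)
    (hy : 0 < y) : IntervalIntegrable f volume x y :=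
  (integrableOn_Icc_of_pos hf (lt_min hx hy) (max x y)).intervalIntegrable

theorem primit_sub (hf : LocallyIntegrableOn f (Ioi 0)) {x y : ℝ} (hx : 0 < x) (hy : 0 < y) :
    primit f y - primit f x = ∫ z in x..y, f z :=
  intervalIntegral.integral_interval_sub_left (intervalIntegrable_of_pos hf one_pos hy)
    (intervalIntegrable_of_pos hf one_pos hx)

theorem continuousOn_primit (hf : LocallyIntegrableOn f (Ioi 0)) :
    ContinuousOn (primit f) (Ioi 0) := by
  intro x hx
  replace hx : 0 < x := hx
  have h := intervalIntegral.continuousOn_primitive_interval'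
    (intervalIntegrable_of_pos hf (show 0 < min x 1 / 2 by positivity)
      (show 0 < max x 1 + 1 by positivity)) (a := 1) ?_
  · refine (h.continuousAt ?_).continuousWithinAt
    rw [uIcc_of_le]
    · refine Icc_mem_nhds ?_ ?_
      · linarith [min_le_left x 1]
      · linarith [le_max_left x 1]
    · linarith [min_le_left x 1, le_max_left x 1]
  · rw [uIcc_of_le]
    · exact ⟨by linarith [min_le_right x 1], by linarith [le_max_right x 1]⟩
    · linarith [min_le_left x 1, le_max_left x 1]

theorem ae_Ioc_of_ae_Ioi {P : ℝ → Prop} (h : ∀ᵐ x ∂volume.restrict (Ioi (0 : ℝ)), P x) {x : ℝ}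
    (hx : 0 ≤ x) (y : ℝ) : ∀ᵐ x ∂volume.restrict (Ioc x y), P x :=
  ae_restrict_of_ae_restrict_of_subset (fun _ hz => hx.trans_lt hz.1) h

theorem monotoneOn_primit (hf : LocallyIntegrableOn f (Ioi 0))
    (h0 : ∀ᵐ x ∂volume.restrict (Ioi (0 : ℝ)), 0 ≤ f x) : MonotoneOn (primit f) (Ioi 0) := by
  intro x hx y hy hxy
  rw [← sub_nonneg, primit_sub hf hx hy, intervalIntegral.integral_of_le hxy]
  exact integral_nonneg_of_ae (ae_Ioc_of_ae_Ioi h0 (le_of_lt hx) y)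

theorem ae_eq_zero_of_primit_le (hf : LocallyIntegrableOn f (Ioi 0))
    (h0 : ∀ᵐ x ∂volume.restrict (Ioi (0 : ℝ)), 0 ≤ f x) {x y : ℝ} (hx : 0 < x) (hxy : x ≤ y)
    (h : primit f y ≤ primit f x) : ∀ᵐ z ∂volume.restrict (Ioc x y), f z = 0 := by
  have hint : ∫ z in Ioc x y, f z = 0 := by
    rw [← intervalIntegral.integral_of_le hxy, ← primit_sub hf hx (hx.trans_le hxy)]
    exact sub_eq_zero.2 (h.antisymm (monotoneOn_primit hf h0 hx (hx.trans_le hxy) hxy))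
  exact (setIntegral_eq_zero_iff_of_nonneg_ae (ae_Ioc_of_ae_Ioi h0 hx.le y)
    ((integrableOn_Icc_of_pos hf hx y).mono_set Ioc_subset_Icc_self)).1 hint

theorem strictMonoOn_primit (hf : LocallyIntegrableOn f (Ioi 0))
    (h0 : ∀ᵐ x ∂volume.restrict (Ioi (0 : ℝ)), 0 < f x) : StrictMonoOn (primit f) (Ioi 0) := by
  intro x hx y hy hxy
  by_contra! hle
  have h1 := ae_eq_zero_of_primit_le hf (h0.mono fun _ h => h.le) hx hxy.le hle
  have h2 : ∀ᵐ z ∂volume.restrict (Ioc x y), False := by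
    filter_upwards [h1, ae_Ioc_of_ae_Ioi h0 (le_of_lt hx) y] with z hz hz'
    exact hz'.ne' hz
  rw [eventually_false_iff_eq_bot, ae_eq_bot, Measure.restrict_eq_zero, Real.volume_Ioc,
    ENNReal.ofReal_eq_zero] at h2
  linarith

theorem exists_primit_lt (hf : LocallyIntegrableOn f (Ioi 0))
    (h0 : ∀ᵐ x ∂volume.restrict (Ioi (0 : ℝ)), 0 ≤ f x)
    (hne : ¬ ∀ᵐ x ∂volume.restrict (Ioi (0 : ℝ)), f x = 0) :
    ∃ x y, 0 < x ∧ x < y ∧ primit f x < primit f y := by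
  by_contra! hle
  refine hne ?_
  -- A constant primitive makes `f` vanish almost everywhere on each interval of a countable
  -- exhaustion of `(0,∞)`.
  have hU : Ioi (0 : ℝ) ⊆ ⋃ n : ℕ, Ioc (1 / ((n : ℝ) + 1)) (n + 2) := by
    intro x hx
    obtain ⟨n, hn⟩ := exists_nat_one_div_lt (show (0 : ℝ) < x from hx)
    obtain ⟨m, hm⟩ := exists_nat_gt x
    refine mem_iUnion.2 ⟨max n m, ?_, ?_⟩
    · refine lt_of_le_of_lt ?_ hn
      gcongr
      exact le_max_left _ _
    · have : (m : ℝ) ≤ (max n m : ℕ) := by exact_mod_cast le_max_right n m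
      linarith
  refine ae_restrict_of_ae_restrict_of_subset hU ((ae_restrict_iUnion_iff _ _).2 fun n => ?_)
  have hp : (0 : ℝ) < 1 / ((n : ℝ) + 1) := by positivity
  have hlt : 1 / ((n : ℝ) + 1) < n + 2 := by
    rw [div_lt_iff₀ (by positivity)]
    nlinarith [(Nat.cast_nonneg n : (0 : ℝ) ≤ n)]
  exact ae_eq_zero_of_primit_le hf h0 hp hlt.le (hle _ _ hp hlt)

theorem setIntegral_norm_eq_primit_sub (hf : LocallyIntegrableOn f (Ioi 0))
    (h0 : ∀ᵐ x ∂volume.restrict (Ioi (0 : ℝ)), 0 ≤ f x) {x y : ℝ} (hx : 0 < x) (hxy : x ≤ y) :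
    ∫ z in Ioc x y, ‖f z‖ = primit f y - primit f x := by
  rw [primit_sub hf hx (hx.trans_le hxy), intervalIntegral.integral_of_le hxy]
  refine integral_congr_ae ?_
  filter_upwards [ae_Ioc_of_ae_Ioi h0 hx.le y] with z hz
  rw [Real.norm_of_nonneg hz]

/-- By monotonicity it is enough that the primitive is unbounded below; a lower bound would bound
the integrals of `‖f‖` over `(1/(n+1), c]` and give integrability up to `0`. -/
theorem tendsto_primit_atBot (hf : LocallyIntegrableOn f (Ioi 0))
    (h0 : ∀ᵐ x ∂volume.restrict (Ioi (0 : ℝ)), 0 ≤ f x) {c : ℝ} (hc : 0 < c)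
    (hni : ¬ IntegrableOn f (Ioo 0 c)) : Tendsto (primit f) (𝓝[>] 0) atBot := by
  rw [tendsto_atBot]
  intro N
  have hex : ∃ x, 0 < x ∧ primit f x ≤ N := by
    by_contra! hN
    refine hni (IntegrableOn.mono_set ?_ Ioo_subset_Ioc_self)
    have ha : Tendsto (fun n : ℕ => 1 / ((n : ℝ) + 1)) atTop (𝓝 0) :=
      tendsto_one_div_add_atTop_nhds_zero_nat
    refine integrableOn_Ioc_of_intervalIntegral_norm_bounded_left (I := primit f c - N)
      (a := fun n : ℕ => 1 / ((n : ℝ) + 1)) (l := atTop) (fun n => ?_) ha ?_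
    · exact (integrableOn_Icc_of_pos hf (by positivity) c).mono_set Ioc_subset_Icc_self
    · filter_upwards [ha.eventually_lt_const hc] with n hn
      have hp : (0 : ℝ) < 1 / ((n : ℝ) + 1) := by positivity
      rw [setIntegral_norm_eq_primit_sub hf h0 hp hn.le]
      linarith [hN _ hp]
  obtain ⟨x, hx, hxN⟩ := hex
  filter_upwards [self_mem_nhdsWithin, nhdsWithin_le_nhds (eventually_lt_nhds hx)] with y hy hyx
  exact (monotoneOn_primit hf h0 hy hx hyx.le).trans hxN

theorem tendsto_primit_atTop (hf : LocallyIntegrableOn f (Ioi 0))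
    (h0 : ∀ᵐ x ∂volume.restrict (Ioi (0 : ℝ)), 0 ≤ f x) {c : ℝ} (hc : 0 < c)
    (hni : ¬ IntegrableOn f (Ioi c)) : Tendsto (primit f) atTop atTop := by
  rw [tendsto_atTop]
  intro N
  have hex : ∃ x, 0 < x ∧ N ≤ primit f x := by
    by_contra! hN
    refine hni ?_
    refine integrableOn_Ioi_of_intervalIntegral_norm_bounded (N - primit f c) c
      (b := fun x : ℕ => (x : ℝ)) (l := atTop) (fun x => ?_) tendsto_natCast_atTop_atTop ?_
    · exact (integrableOn_Icc_of_pos hf hc x).mono_set Ioc_subset_Icc_self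
    · filter_upwards [tendsto_natCast_atTop_atTop.eventually_ge_atTop c] with x hx
      rw [intervalIntegral.integral_of_le hx, setIntegral_norm_eq_primit_sub hf h0 hc hx]
      linarith [hN _ (hc.trans_le hx)]
  obtain ⟨x, hx, hxN⟩ := hex
  filter_upwards [eventually_ge_atTop x] with y hy
  exact hxN.trans (monotoneOn_primit hf h0 hx (hx.trans_le hy) hy)

end Primitive

/-! ### From the weights to the functions `a` and `b` -/

theorem not_integrable_of_eLpNorm_eq_top {μ : Measure ℝ} {u f : ℝ → ℝ} {q : ℝ} (hq : 0 < q)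
    (hu : AEStronglyMeasurable u μ) (huf : ∀ᵐ x ∂μ, |u x| ^ q = f x)
    (h : eLpNorm u (ENNReal.ofReal q) μ = ∞) : ¬ Integrable f μ := by
  intro hf
  have h1 : MemLp u (ENNReal.ofReal q) μ := by
    rw [← integrable_norm_rpow_iff hu (ENNReal.ofReal_pos.2 hq).ne' ENNReal.ofReal_ne_top,
      ENNReal.toReal_ofReal hq.le]
    exact hf.congr (huf.mono fun x hx => hx.symm)
  exact h1.2.ne h

section Weights

variable {p : ℝ} {v₀ v₁ : ℝ → ℝ}

/-- The standing assumptions on the exponent and the weights. -/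
structure Admissible (p : ℝ) (v₀ v₁ : ℝ → ℝ) : Prop where
  one_lt : 1 < p
  weight₀ : IsWeight p v₀
  weight₁ : IsWeight p v₁
  inv : InvLocLp p.conjExponent v₁
  endpoint : EndpointCondition p v₀ v₁

namespace Admissible

theorem pos (H : Admissible p v₀ v₁) : 0 < p := one_pos.trans H.one_lt

theorem conj_pos (H : Admissible p v₀ v₁) : 0 < p.conjExponent :=
  (Real.HolderConjugate.conjExponent H.one_lt).symm.pos

theorem dens_pos (H : Admissible p v₀ v₁) :
    ∀ᵐ x ∂volume.restrict (Ioi (0 : ℝ)), 0 < dens p v₁ x :=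
  H.inv.1.mono fun _ hx => Real.rpow_pos_of_pos hx _

theorem dens_nonneg (H : Admissible p v₀ v₁) :
    ∀ᵐ x ∂volume.restrict (Ioi (0 : ℝ)), 0 ≤ dens p v₁ x := H.dens_pos.mono fun _ hx => hx.le

theorem dens_loc (H : Admissible p v₀ v₁) : LocallyIntegrableOn (dens p v₁) (Ioi 0) := H.inv.2

theorem rpow_nonneg (H : Admissible p v₀ v₁) :
    ∀ᵐ x ∂volume.restrict (Ioi (0 : ℝ)), 0 ≤ v₀ x ^ p :=
  H.weight₀.nonneg.mono fun _ hx => Real.rpow_nonneg hx _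

theorem rpow_loc (H : Admissible p v₀ v₁) : LocallyIntegrableOn (fun x => v₀ x ^ p) (Ioi 0) :=
  H.weight₀.locallyIntegrable

theorem not_integrableOn (H : Admissible p v₀ v₁) {s : Set ℝ} (hs : s ⊆ Ioi 0)
    (h : eLpNorm (fun x => (v₁ x)⁻¹) (ENNReal.ofReal p.conjExponent) (volume.restrict s) *
      eLpNorm v₀ (ENNReal.ofReal p) (volume.restrict s) = ∞) :
    ¬ IntegrableOn (dens p v₁) s ∨ ¬ IntegrableOn (fun x => v₀ x ^ p) s := by
  have hle : volume.restrict s ≤ volume.restrict (Ioi (0 : ℝ)) := Measure.restrict_mono hs le_rfl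
  rcases ENNReal.mul_eq_top.1 h with h | h
  · right
    refine not_integrable_of_eLpNorm_eq_top H.pos
      (H.weight₀.aemeasurable.mono_measure hle).aestronglyMeasurable ?_ h.2
    filter_upwards [ae_restrict_of_ae_restrict_of_subset hs H.weight₀.nonneg] with x hx
    rw [abs_of_nonneg hx]
  · left
    refine not_integrable_of_eLpNorm_eq_top H.conj_pos
      (H.weight₁.aemeasurable.mono_measure hle).inv.aestronglyMeasurable ?_ h.1
    filter_upwards [ae_restrict_of_ae_restrict_of_subset hs H.inv.1] with x hx
    rw [Pi.inv_apply, abs_of_pos (inv_pos.2 hx), dens, Real.rpow_neg hx.le, Real.inv_rpow hx.le]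

theorem isBalanced_iff (H : Admissible p v₀ v₁) {t α β : ℝ} :
    IsOinarovOtelbaev p v₀ v₁ t α β ↔ IsBalanced (1 / p.conjExponent) (1 / p)
      (primit (dens p v₁)) (primit fun x => v₀ x ^ p) t α β := by
  constructor
  · rintro ⟨h1, h2, h3, h4, h5⟩
    have ht := h1.trans h2
    refine ⟨h1, h2, h3, ?_, ?_⟩
    · rwa [primit_sub H.dens_loc h1 ht, primit_sub H.dens_loc ht (ht.trans h3)]
    · rwa [primit_sub H.dens_loc h1 (ht.trans h3), primit_sub H.rpow_loc h1 (ht.trans h3)]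
  · rintro ⟨h1, h2, h3, h4, h5⟩
    have ht := h1.trans h2
    refine ⟨h1, h2, h3, ?_, ?_⟩
    · rwa [← primit_sub H.dens_loc h1 ht, ← primit_sub H.dens_loc ht (ht.trans h3)]
    · rwa [← primit_sub H.dens_loc h1 (ht.trans h3), ← primit_sub H.rpow_loc h1 (ht.trans h3)]

/-- The pair is a choice by `Classical.epsilon`, so it carries information only once existence is
known. Monotonicity then holds for any choice, and uniqueness is not used. -/
theorem balanced (H : Admissible p v₀ v₁) {t : ℝ} (ht : 0 < t) :
    IsBalanced (1 / p.conjExponent) (1 / p) (primit (dens p v₁)) (primit fun x => v₀ x ^ p) t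
      (aFun p v₀ v₁ t) (bFun p v₀ v₁ t) := by
  obtain ⟨c, hc, e1, e2⟩ := H.endpoint
  have h0 := (H.not_integrableOn Ioo_subset_Ioi_self e1).imp
    (tendsto_primit_atBot H.dens_loc H.dens_nonneg hc)
    (tendsto_primit_atBot H.rpow_loc H.rpow_nonneg hc)
  have hinf := (H.not_integrableOn (Ioi_subset_Ioi hc.le) e2).imp
    (tendsto_primit_atTop H.dens_loc H.dens_nonneg hc)
    (tendsto_primit_atTop H.rpow_loc H.rpow_nonneg hc)
  have hne := exists_primit_lt H.rpow_loc H.rpow_nonneg fun hz => H.weight₀.ne_zero <| by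
    refine (eLpNorm_congr_ae ?_).trans eLpNorm_zero
    filter_upwards [hz, H.weight₀.nonneg] with x hx hx0
    exact (Real.rpow_eq_zero hx0 H.pos.ne').1 hx
  obtain ⟨α, β, hαβ⟩ := exists_balanced (one_div_pos.2 H.conj_pos) (one_div_pos.2 H.pos)
    (strictMonoOn_primit H.dens_loc H.dens_pos) (continuousOn_primit H.dens_loc)
    (monotoneOn_primit H.rpow_loc H.rpow_nonneg) (continuousOn_primit H.rpow_loc) h0 hinf hne ht
  have hex : ∃ q : ℝ × ℝ, IsOinarovOtelbaev p v₀ v₁ t q.1 q.2 := ⟨(α, β), H.isBalanced_iff.2 hαβ⟩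
  exact H.isBalanced_iff.1 (Classical.epsilon_spec hex)

theorem a_b_lt (H : Admissible p v₀ v₁) {t s : ℝ} (ht : 0 < t) (hts : t < s) :
    aFun p v₀ v₁ t < aFun p v₀ v₁ s ∧ bFun p v₀ v₁ t < bFun p v₀ v₁ s :=
  (H.balanced ht).lt_lt (one_div_pos.2 H.conj_pos) (one_div_pos.2 H.pos)
    (strictMonoOn_primit H.dens_loc H.dens_pos) (monotoneOn_primit H.rpow_loc H.rpow_nonneg)
    (H.balanced (ht.trans hts)) hts

theorem strictMonoOn_a (H : Admissible p v₀ v₁) : StrictMonoOn (aFun p v₀ v₁) (Ioi 0) :=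
  fun _ hx _ _ hxy => (H.a_b_lt hx hxy).1

theorem strictMonoOn_b (H : Admissible p v₀ v₁) : StrictMonoOn (bFun p v₀ v₁) (Ioi 0) :=
  fun _ hx _ _ hxy => (H.a_b_lt hx hxy).2

theorem V1_eq (H : Admissible p v₀ v₁) {t : ℝ} (ht : 0 < t) :
    V1 p v₀ v₁ t = primit (dens p v₁) (bFun p v₀ v₁ t) - primit (dens p v₁) (aFun p v₀ v₁ t) := by
  have h := H.balanced ht
  rw [primit_sub H.dens_loc h.pos (h.pos.trans (h.left_lt.trans h.lt_right)), V1]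

end Admissible

end Weights

/-! ### Norm estimates and construction of `g` -/

section Weights

variable {p : ℝ} {v₀ v₁ : ℝ → ℝ}

theorem lintegral_rpow_mul_rpow_le {q : ℝ} (hq : 0 < q) {f Ψ : ℝ → ℝ≥0∞} {M : ℝ≥0∞} (hM : M ≠ ∞)
    {s : Set ℝ} (hs : MeasurableSet s) (h0 : ∀ t, 0 < t → t ∉ s → Ψ t = 0)
    (h : ∀ t ∈ s, Ψ t ≤ M) :
    (∫⁻ t in Ioi (0 : ℝ), Ψ t ^ q * f t) ^ (1 / q) ≤ M * (∫⁻ t in s, f t) ^ (1 / q) := by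
  have h1 : ∫⁻ t in Ioi (0 : ℝ), Ψ t ^ q * f t ≤ M ^ q * ∫⁻ t in s, f t := by
    calc ∫⁻ t in Ioi (0 : ℝ), Ψ t ^ q * f t
        ≤ ∫⁻ t in Ioi (0 : ℝ), s.indicator (fun t => M ^ q * f t) t := by
          refine setLIntegral_mono' measurableSet_Ioi fun t ht => ?_
          by_cases hts : t ∈ s
          · rw [indicator_of_mem hts]
            gcongr
            exact h t hts
          · rw [h0 t ht hts, ENNReal.zero_rpow_of_pos hq, zero_mul]
            exact zero_le
      _ ≤ ∫⁻ t, s.indicator (fun t => M ^ q * f t) t := setLIntegral_le_lintegral _ _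
      _ = M ^ q * ∫⁻ t in s, f t := by
          rw [lintegral_indicator hs, lintegral_const_mul' _ _ (ENNReal.rpow_ne_top_of_nonneg hq.le hM)]
  calc (∫⁻ t in Ioi (0 : ℝ), Ψ t ^ q * f t) ^ (1 / q)
      ≤ (M ^ q * ∫⁻ t in s, f t) ^ (1 / q) := ENNReal.rpow_le_rpow h1 (by positivity)
    _ = M * (∫⁻ t in s, f t) ^ (1 / q) := by
        rw [ENNReal.mul_rpow_of_nonneg _ _ (by positivity), ← ENNReal.rpow_mul,
          mul_one_div_cancel hq.ne', ENNReal.rpow_one]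

theorem lintegral_ofReal_mul_rpow_le {q : ℝ} (hq : 0 < q) {f Ψ : ℝ → ℝ} {η : ℝ}
    {s : Set ℝ} (hs : MeasurableSet s) (h0 : ∀ t, 0 < t → t ∉ s → Ψ t = 0)
    (h : ∀ t ∈ s, |Ψ t| ≤ η) :
    (∫⁻ t in Ioi (0 : ℝ), ENNReal.ofReal (f t * |Ψ t| ^ q)) ^ (1 / q) ≤
      ENNReal.ofReal η * (∫⁻ t in s, ENNReal.ofReal (f t)) ^ (1 / q) := by
  refine le_trans (le_of_eq ?_) (lintegral_rpow_mul_rpow_le hq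
    (f := fun t => ENNReal.ofReal (f t)) (Ψ := fun t => ENNReal.ofReal |Ψ t|)
    ENNReal.ofReal_ne_top hs (fun t ht hts => by simp [h0 t ht hts])
    fun t ht => ENNReal.ofReal_le_ofReal (h t ht))
  congr 2 with t
  rw [ENNReal.ofReal_mul' (by positivity), ENNReal.ofReal_rpow_of_nonneg (abs_nonneg _) hq.le,
    mul_comm]

namespace Admissible

/-- Order connectedness is all that the Riemann–Lebesgue lemma asks, so `a⁻¹(t) = ∞` needs no
separate treatment. -/
theorem ordConnected_toInv (H : Admissible p v₀ v₁) {t : ℝ} (ht : 0 < t) :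
    (toInv (aFun p v₀ v₁) t).OrdConnected :=
  ⟨fun _ hx _ hy _ hz => ⟨hx.1.trans_le hz.1, (H.strictMonoOn_a.monotoneOn
    (ht.trans (hx.1.trans_le hz.1)) (ht.trans hy.1) hz.2).trans_lt hy.2⟩⟩

/-- This confines the outer integration to a bounded interval away from `0` when `g` vanishes off
`[c,d]`. -/
theorem mem_Ioo_of_mem_toInv (H : Admissible p v₀ v₁) {c d t x : ℝ} (hc : 0 < c)
    (hx : x ∈ Icc c d) (hxt : x ∈ toInv (aFun p v₀ v₁) t) : t ∈ Ioo (aFun p v₀ v₁ c) d :=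
  ⟨(H.strictMonoOn_a.monotoneOn hc (hc.trans_le hx.1) hx.1).trans_lt hxt.2, hxt.1.trans_le hx.2⟩

theorem a_pos (H : Admissible p v₀ v₁) {t : ℝ} (ht : 0 < t) : 0 < aFun p v₀ v₁ t :=
  (H.balanced ht).pos

theorem b_pos (H : Admissible p v₀ v₁) {t : ℝ} (ht : 0 < t) : 0 < bFun p v₀ v₁ t :=
  ht.trans (H.balanced ht).lt_right

theorem monotoneOn_primit_dens (H : Admissible p v₀ v₁) :
    MonotoneOn (primit (dens p v₁)) (Ioi 0) :=
  (strictMonoOn_primit H.dens_loc H.dens_pos).monotoneOn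

theorem monotoneOn_primit_a (H : Admissible p v₀ v₁) :
    MonotoneOn (fun x => primit (dens p v₁) (aFun p v₀ v₁ x)) (Ioi 0) :=
  fun _ hx _ hy hxy => H.monotoneOn_primit_dens (H.a_pos hx) (H.a_pos hy)
    (H.strictMonoOn_a.monotoneOn hx hy hxy)

theorem monotoneOn_primit_b (H : Admissible p v₀ v₁) :
    MonotoneOn (fun x => primit (dens p v₁) (bFun p v₀ v₁ x)) (Ioi 0) :=
  fun _ hx _ hy hxy => H.monotoneOn_primit_dens (H.b_pos hx) (H.b_pos hy)
    (H.strictMonoOn_b.monotoneOn hx hy hxy)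

theorem V1_pos (H : Admissible p v₀ v₁) {t : ℝ} (ht : 0 < t) : 0 < V1 p v₀ v₁ t := by
  have h := H.balanced ht
  rw [H.V1_eq ht, sub_pos]
  exact strictMonoOn_primit H.dens_loc H.dens_pos (H.a_pos ht) (H.b_pos ht)
    (h.left_lt.trans h.lt_right)

theorem V1_le (H : Admissible p v₀ v₁) {s t r : ℝ} (hs : 0 < s) (hst : s ≤ t) (htr : t ≤ r) :
    V1 p v₀ v₁ t ≤
      primit (dens p v₁) (bFun p v₀ v₁ r) - primit (dens p v₁) (aFun p v₀ v₁ s) := by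
  have ht := hs.trans_le hst
  rw [H.V1_eq ht]
  exact sub_le_sub (H.monotoneOn_primit_b ht (ht.trans_le htr) htr)
    (H.monotoneOn_primit_a hs ht hst)

/-- The normalization makes `V₁(x)^{1/p'}` the reciprocal of a power of the mass of `v₀^p` on
`[a(x), b(x)]`, which is at most its mass on `[a(c), b(d)]`. -/
theorem exists_le_V1 (H : Admissible p v₀ v₁) {c d : ℝ} (hc : 0 < c) :
    ∃ κ, 0 < κ ∧ ∀ x ∈ Icc c d, κ ≤ V1 p v₀ v₁ x := by
  set W := primit fun x => v₀ x ^ p with hW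
  have hWm : MonotoneOn W (Ioi 0) := monotoneOn_primit H.rpow_loc H.rpow_nonneg
  -- The maximum with `1` makes `m` positive without examining the increment.
  set m := max (W (bFun p v₀ v₁ d) - W (aFun p v₀ v₁ c)) 1 ^ (1 / p) with hm
  have hm0 : 0 < m := Real.rpow_pos_of_pos (by positivity) _
  refine ⟨(1 / m) ^ p.conjExponent, by positivity, fun x hx => ?_⟩
  have hx0 := hc.trans_le hx.1
  have hd0 := hx0.trans_le hx.2
  have h := H.balanced hx0
  have hn := h.normalized
  rw [← H.V1_eq hx0] at hn
  have hV := H.V1_pos hx0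
  have w1 := hWm (H.b_pos hx0) (H.b_pos hd0) (H.strictMonoOn_b.monotoneOn hx0 hd0 hx.2)
  have w2 := hWm (H.a_pos hc) (H.a_pos hx0) (H.strictMonoOn_a.monotoneOn hc hx0 hx.1)
  have w3 := hWm (H.a_pos hx0) (H.b_pos hx0) (h.left_lt.trans h.lt_right).le
  have h1 : (W (bFun p v₀ v₁ x) - W (aFun p v₀ v₁ x)) ^ (1 / p) ≤ m :=
    Real.rpow_le_rpow (by linarith) (le_trans (by linarith) (le_max_left _ _))
      (one_div_pos.2 H.pos).le
  have h2 : 1 / m ≤ V1 p v₀ v₁ x ^ (1 / p.conjExponent) := by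
    rw [div_le_iff₀ hm0]
    refine hn.ge.trans ?_
    exact mul_le_mul_of_nonneg_left h1 (Real.rpow_nonneg hV.le _)
  calc (1 / m) ^ p.conjExponent
      ≤ (V1 p v₀ v₁ x ^ (1 / p.conjExponent)) ^ p.conjExponent :=
        Real.rpow_le_rpow (by positivity) h2 H.conj_pos.le
    _ = V1 p v₀ v₁ x := by
        rw [← Real.rpow_mul hV.le, one_div_mul_cancel H.conj_pos.ne', Real.rpow_one]

theorem aemeasurable_primit_a (H : Admissible p v₀ v₁) {c d : ℝ} (hc : 0 < c) :
    AEMeasurable (fun x => primit (dens p v₁) (aFun p v₀ v₁ x)) (volume.restrict (Icc c d)) :=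
  aemeasurable_restrict_of_monotoneOn measurableSet_Icc
    (H.monotoneOn_primit_a.mono fun _ hx => hc.trans_le hx.1)

/-- `V₁` is a difference of two monotone functions of `x`; continuity of `a` and `b` is not needed.
-/
theorem aemeasurable_V1 (H : Admissible p v₀ v₁) {c d : ℝ} (hc : 0 < c) :
    AEMeasurable (V1 p v₀ v₁) (volume.restrict (Icc c d)) := by
  have hb : AEMeasurable (fun x => primit (dens p v₁) (bFun p v₀ v₁ x))
      (volume.restrict (Icc c d)) :=
    aemeasurable_restrict_of_monotoneOn measurableSet_Icc
      (H.monotoneOn_primit_b.mono fun _ hx => hc.trans_le hx.1)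
  refine (hb.sub (H.aemeasurable_primit_a hc)).congr ?_
  filter_upwards [ae_restrict_mem measurableSet_Icc] with x hx
  exact (H.V1_eq (hc.trans_le hx.1)).symm

theorem integrableOn_div_V1 (H : Admissible p v₀ v₁) {c d : ℝ} (hc : 0 < c) {h : ℝ → ℝ}
    (hh : IntegrableOn h (Icc c d)) : IntegrableOn (fun x => h x / V1 p v₀ v₁ x) (Icc c d) := by
  obtain ⟨κ, hκ, hV⟩ := H.exists_le_V1 (d := d) hc
  simp_rw [div_eq_mul_inv]
  refine hh.mul_bdd (c := κ⁻¹) (H.aemeasurable_V1 hc).inv.aestronglyMeasurable ?_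
  filter_upwards [ae_restrict_mem measurableSet_Icc] with x hx
  rw [Real.norm_of_nonneg (inv_nonneg.2 (hκ.le.trans (hV x hx)))]
  exact inv_anti₀ hκ (hV x hx)

theorem integrableOn_mul_primit_a (H : Admissible p v₀ v₁) {c d : ℝ} (hc : 0 < c) {h : ℝ → ℝ}
    (hh : IntegrableOn h (Icc c d)) :
    IntegrableOn (fun x => h x * primit (dens p v₁) (aFun p v₀ v₁ x)) (Icc c d) := by
  refine hh.mul_bdd (c := max |primit (dens p v₁) (aFun p v₀ v₁ c)|
    |primit (dens p v₁) (aFun p v₀ v₁ d)|) (H.aemeasurable_primit_a hc).aestronglyMeasurable ?_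
  filter_upwards [ae_restrict_mem measurableSet_Icc] with x hx
  have hx0 := hc.trans_le hx.1
  exact abs_le_max_abs_abs (H.monotoneOn_primit_a hc hx0 hx.1)
    (H.monotoneOn_primit_a hx0 (hx0.trans_le hx.2) hx.2)

/-- The free factor `k` covers both norms: the kernel of `𝔾`, and `1` for `𝒢`. -/
theorem setIntegral_toInv_eq_zero (H : Admissible p v₀ v₁) {c d t : ℝ} (hc : 0 < c) {g k : ℝ → ℝ}
    (hg : ∀ x, x ∉ Icc c d → g x = 0) (ht : t ∉ Ioo (aFun p v₀ v₁ c) d) :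
    ∫ x in toInv (aFun p v₀ v₁) t, g x / V1 p v₀ v₁ x * k x = 0 := by
  refine setIntegral_eq_zero_of_forall_eq_zero fun x hx => ?_
  rw [hg x fun hxc => ht (H.mem_Ioo_of_mem_toInv hc hxc hx), zero_div, zero_mul]

theorem lintegral_dens_lt_top (H : Admissible p v₀ v₁) {x : ℝ} (hx : 0 < x) (y : ℝ) :
    (∫⁻ t in Ioo x y, ENNReal.ofReal (dens p v₁ t)) ^ (1 / p.conjExponent) < ∞ :=
  ENNReal.rpow_lt_top_of_nonneg (one_div_pos.2 H.conj_pos).le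
    ((lintegral_mono fun _ => Real.ofReal_le_enorm _).trans_lt
      ((integrableOn_Icc_of_pos H.dens_loc hx y).mono_set Ioo_subset_Icc_self).2).ne

theorem mem_bbW_of_integrable (H : Admissible p v₀ v₁) {c d : ℝ} (hc : 0 < c) {g : ℝ → ℝ}
    (hgi : Integrable g) (hg : ∀ x, x ∉ Icc c d → g x = 0) : g ∈ bbW p v₀ v₁ := by
  refine ⟨hgi.integrableOn.locallyIntegrableOn, ?_⟩
  refine (lintegral_rpow_mul_rpow_le (s := Ioo (aFun p v₀ v₁ c) d) (M := ∫⁻ x, ‖g x‖ₑ) H.conj_pos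
    hgi.2.ne measurableSet_Ioo
    (fun t _ hts => ?_) fun t _ => setLIntegral_le_lintegral _ _).trans_lt
    (ENNReal.mul_lt_top hgi.2 (H.lintegral_dens_lt_top (H.a_pos hc) d))
  have hm : ∀ x ∈ toInv (aFun p v₀ v₁) t, ‖g x‖ₑ = 0 := fun x hx => by
    rw [hg x fun hxc => hts (H.mem_Ioo_of_mem_toInv hc hxc hx), enorm_zero]
  exact nonpos_iff_eq_zero.1 ((setLIntegral_mono measurable_zero
    fun x hx => (hm x hx).le).trans_eq lintegral_zero)

theorem exists_scrWNorm_lt (H : Admissible p v₀ v₁) {c d : ℝ} (hc : 0 < c) (hcd : c ≤ d)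
    {h : ℝ → ℝ} (hh : IntegrableOn h (Icc c d)) {ε : ℝ} (hε : 0 < ε) :
    ∃ g ∈ bbW p v₀ v₁, (∀ x ∈ Icc c d, |g x| = |h x|) ∧
      scrWNorm p v₀ v₁ g < ENNReal.ofReal ε := by
  set F := primit (dens p v₁) with hF
  set A := aFun p v₀ v₁ c with hA
  have hA0 : 0 < A := H.a_pos hc
  have hd : 0 < d := hc.trans_le hcd
  set L := (∫⁻ t in Ioo A d, ENNReal.ofReal (dens p v₁ t)) ^ (1 / p.conjExponent) with hL
  have hLtop : L < ∞ := H.lintegral_dens_lt_top hA0 d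
  set C := max |F A| |F d| with hC
  -- An upper bound for `V₁` on `(A, d)`, by monotonicity of `a` and `b`.
  set C' := max (F (bFun p v₀ v₁ d) - F (aFun p v₀ v₁ A)) 0 with hC'
  have hC0 : 0 ≤ C := (abs_nonneg _).trans (le_max_left _ _)
  have hC'0 : 0 ≤ C' := le_max_right _ _
  -- `C` comes from the factor `F t` in `𝔾`, `1` from its second term, `C'` from `V₁(t)` in `𝒢`, and
  -- `L` from the outer integral over `(A, d)`.
  obtain ⟨δ, hδ, hδε⟩ : ∃ δ : ℝ, 0 < δ ∧ (C + 1 + C') * δ * L.toReal < ε := by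
    have hk : 0 ≤ (C + 1 + C') * L.toReal := by positivity
    refine ⟨ε / ((C + 1 + C') * L.toReal + 1), by positivity, ?_⟩
    rw [show (C + 1 + C') * (ε / ((C + 1 + C') * L.toReal + 1)) * L.toReal =
      ((C + 1 + C') * L.toReal) * ε / ((C + 1 + C') * L.toReal + 1) by ring,
      div_lt_iff₀ (by positivity)]
    nlinarith
  set φ : ℝ → ℝ := (Icc c d).indicator fun x => h x / V1 p v₀ v₁ x with hφ
  set ψ : ℝ → ℝ := (Icc c d).indicator
    fun x => h x / V1 p v₀ v₁ x * F (aFun p v₀ v₁ x) with hψ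
  have hφi : Integrable φ :=
    (integrable_indicator_iff measurableSet_Icc).2 (H.integrableOn_div_V1 hc hh)
  have hψi : Integrable ψ := (integrable_indicator_iff measurableSet_Icc).2
    (H.integrableOn_mul_primit_a hc (H.integrableOn_div_V1 hc hh))
  obtain ⟨η, hη₁, hη₂⟩ := ((eventually_integral_squareWave_le hφi hδ).and
    (eventually_integral_squareWave_le hψi hδ)).exists
  set g : ℝ → ℝ := fun x => (Icc c d).indicator h x * squareWave η x with hg
  have hgi : Integrable g :=
    integrable_mul_squareWave ((integrable_indicator_iff measurableSet_Icc).2 hh) η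
  have hg0 : ∀ x, x ∉ Icc c d → g x = 0 := fun x hx => by
    simp only [hg, indicator_of_notMem hx, zero_mul]
  refine ⟨g, H.mem_bbW_of_integrable hc hgi hg0, fun x hx => ?_, ?_⟩
  · simp only [hg, indicator_of_mem hx, abs_mul, abs_squareWave, mul_one]
  have hgφ : ∀ x, g x / V1 p v₀ v₁ x = φ x * squareWave η x := fun x => by
    by_cases hx : x ∈ Icc c d
    · simp only [hg, hφ, indicator_of_mem hx]
      ring
    · simp only [hg, hφ, indicator_of_notMem hx, zero_mul, zero_div]
  have hgψ : ∀ x, g x / V1 p v₀ v₁ x * F (aFun p v₀ v₁ x) = ψ x * squareWave η x := fun x => by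
    by_cases hx : x ∈ Icc c d
    · simp only [hg, hψ, indicator_of_mem hx]
      ring
    · simp only [hg, hψ, indicator_of_notMem hx, zero_mul, zero_div]
  have hbb : bbG p v₀ v₁ g ≤ ENNReal.ofReal ((C + 1) * δ) * L := by
    refine lintegral_ofReal_mul_rpow_le H.conj_pos measurableSet_Ioo
      (fun t _ ht => H.setIntegral_toInv_eq_zero hc hg0 ht) fun t ht => ?_
    have ht0 : 0 < t := hA0.trans ht.1
    have hT := H.ordConnected_toInv ht0
    -- Since the kernel is `F t - F (a x)`, the variable `t` separates and only the fixed functions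
    -- `φ` and `ψ` meet the wave.
    have e : ∫ x in toInv (aFun p v₀ v₁) t,
        g x / V1 p v₀ v₁ x * ∫ y in aFun p v₀ v₁ x..t, dens p v₁ y =
        F t * (∫ x in toInv (aFun p v₀ v₁) t, φ x * squareWave η x) -
          ∫ x in toInv (aFun p v₀ v₁) t, ψ x * squareWave η x := by
      rw [← integral_const_mul, ← integral_sub
        ((integrable_mul_squareWave hφi.integrableOn η).const_mul _)
        (integrable_mul_squareWave hψi.integrableOn η)]
      refine setIntegral_congr_fun hT.measurableSet fun x hx => ?_
      rw [← primit_sub H.dens_loc (H.a_pos (ht0.trans hx.1)) ht0, ← hgψ, ← hgφ]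
      ring
    have hFt : |F t| ≤ C := abs_le_max_abs_abs (H.monotoneOn_primit_dens hA0 ht0 ht.1.le)
      (H.monotoneOn_primit_dens ht0 hd ht.2.le)
    rw [e]
    refine (abs_sub _ _).trans ?_
    rw [abs_mul]
    have := mul_le_mul hFt (hη₁ _ hT) (abs_nonneg _) hC0
    linarith [hη₂ _ hT]
  have hcal : calG p v₀ v₁ g ≤ ENNReal.ofReal (C' * δ) * L := by
    have e : calG p v₀ v₁ g = (∫⁻ t in Ioi (0 : ℝ), ENNReal.ofReal (dens p v₁ t *
        |V1 p v₀ v₁ t * ∫ x in toInv (aFun p v₀ v₁) t, g x / V1 p v₀ v₁ x * 1| ^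
          p.conjExponent)) ^ (1 / p.conjExponent) := by
      rw [calG]
      congr 1
      refine setLIntegral_congr_fun measurableSet_Ioi fun t ht => ?_
      have hV := H.V1_pos ht
      simp only [mul_one]
      rw [abs_mul, abs_of_pos hV, Real.mul_rpow hV.le (abs_nonneg _), mul_assoc]
    rw [e]
    refine lintegral_ofReal_mul_rpow_le H.conj_pos measurableSet_Ioo
      (fun t _ ht => by rw [H.setIntegral_toInv_eq_zero hc hg0 ht, mul_zero]) fun t ht => ?_
    have ht0 : 0 < t := hA0.trans ht.1
    simp_rw [mul_one, hgφ]
    rw [abs_mul, abs_of_pos (H.V1_pos ht0)]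
    exact mul_le_mul ((H.V1_le hA0 ht.1.le ht.2.le).trans (le_max_left _ _))
      (hη₁ _ (H.ordConnected_toInv ht0)) (abs_nonneg _) hC'0
  calc scrWNorm p v₀ v₁ g
      ≤ ENNReal.ofReal ((C + 1) * δ) * L + ENNReal.ofReal (C' * δ) * L := add_le_add hbb hcal
    _ = ENNReal.ofReal ((C + 1 + C') * δ * L.toReal) := by
        rw [← add_mul, ← ENNReal.ofReal_add (by positivity) (by positivity), ← add_mul,
          ENNReal.ofReal_mul (q := L.toReal) (by positivity), ENNReal.ofReal_toReal hLtop.ne]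
    _ < ENNReal.ofReal ε := (ENNReal.ofReal_lt_ofReal_iff hε).2 hδε

end Admissible

end Weights

end WeightedSobolev

theorem mainTheorem7 (p : ℝ) (hp : 1 < p) (v₀ v₁ : ℝ → ℝ)
    (hv₀ : WeightedSobolev.IsWeight p v₀) (hv₁ : WeightedSobolev.IsWeight p v₁)
    (hinv : WeightedSobolev.InvLocLp p.conjExponent v₁)
    (hend : WeightedSobolev.EndpointCondition p v₀ v₁)
    (c d : ℝ) (hc : 0 < c) (hcd : c ≤ d)
    (h : ℝ → ℝ) (hh : IntegrableOn h (Icc c d) volume)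
    (ε : ℝ) (hε : 0 < ε) :
    ∃ g ∈ WeightedSobolev.bbW p v₀ v₁,
      (∀ x ∈ Icc c d, |g x| = |h x|) ∧
        WeightedSobolev.scrWNorm p v₀ v₁ g < ENNReal.ofReal ε :=
  WeightedSobolev.Admissible.exists_scrWNorm_lt ⟨hp, hv₀, hv₁, hinv, hend⟩ hc hcd hh hε
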